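/- Let $\kappa \in (0, \tfrac12)$ and $\varepsilon_t = t^{-\frac12 + \kappa}$ for $t = 1, 2, \dots$ Let $A$ be a set of two actions; each $a \in A$ has a sub-Gaussian reward distribution $F_a$ on $\mathbb{R}$ with mean zero, and one of the two distributions is deterministic (hence equal to the point mass at $0$). Reweighted $\varepsilon$-Greedy is the following algorithm. In round $t$ it draws an action $a_t$ from the distribution $$\pi_t = (1-\varepsilon_t)\,\mathrm{Unif}\bigl(\arg\max_{a \in A} \mu_{a,r}(t-1)\bigr) + \varepsilon_t\,\mathrm{Unif}(A),$$ and then, given the past and $a_t$, it observes a reward $r_t \sim F_{a_t}$; here, with $N_a(t)$ the number of rounds $t' \le t$ with $a_{t'} = a$, $$\mu_{a,r}(t) = \frac{1}{N_a(t)} \sum_{1 \le t' \le t,\ a_{t'} = a} \frac{r_{t'}}{\sqrt{\pi_{t'}(a)}},$$ and $\mu_{a,r}(t) = 0$ if $N_a(t) = 0$. Then the algorithm is risk-neutral, that is, for any actions $a, a' \in A$ of equal mean reward the limits $\lim_{t\to\infty} \mathbb{P}[a_t = a]$ and $\lim_{t\to\infty} \mathbb{P}[a_t = a']$ exist and are equal.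 In fact, $\lim_{t\to\infty}\mathbb{P}[a_t = a] = \tfrac12$ for each of the two actions $a \in A$. -/

import Mathlib

open MeasureTheory ProbabilityTheory Filter Topology

noncomputable section

namespace Bandit

variable {A : Type*}

/-- A bandit problem with action set `A`: every action `a` carries a reward distribution on `ℝ`
which is sub-Gaussian (around its expectation, with some variance proxy). -/
structure Problem (A : Type*) where
  /-- The reward distribution of an action. -/
  reward : A → Measure ℝ
  isProbabilityMeasure : ∀ a, IsProbabilityMeasure (reward a)
  subGaussian : ∀ a, ∃ c : NNReal,
    HasSubgaussianMGF (fun x : ℝ => x - ∫ y, y ∂(reward a)) c (reward a)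

/-- The expected reward of an action. -/
def Problem.mean (b : Problem A) (a : A) : ℝ := ∫ x, x ∂(b.reward a)

/-- An action is centered if its expected reward is zero. -/
def Problem.IsCentered (b : Problem A) (a : A) : Prop := b.mean a = 0

/-- An action is deterministic if its reward is a constant. -/
def Problem.IsDeterministic (b : Problem A) (a : A) : Prop :=
  ∃ c : ℝ, b.reward a = Measure.dirac c

/-- A strategy (or algorithm): given the actions and rewards of the first `n` rounds, the
distribution of the action chosen in round `n + 1`. -/
abbrev Strategy (A : Type*) : Type _ := (n : ℕ) → (Fin n → A × ℝ) → PMF A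

/-- The actions and rewards of the first `n` rounds. Rounds are numbered from `1`; round `n + 1`
has index `n`, that is, `act n` and `rew n` are its action and its reward. -/
def history {Ω : Type*} (act : ℕ → Ω → A) (rew : ℕ → Ω → ℝ) (n : ℕ) (ω : Ω) : Fin n → A × ℝ :=
  fun i => (act i ω, rew i ω)

/-- The random sequences `act` and `rew` on the probability space `(Ω, P)` are generated by the
strategy `π` in the bandit problem `b`: conditionally on the history before a round, the action of
that round has the distribution given by `π`; conditionally on that history and on the action `a`
of that round, the reward of that round has the reward distribution of `a`. -/
structure IsRun [MeasurableSpace A] (π : Strategy A) (b : Problem A)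
    {Ω : Type*} [MeasurableSpace Ω] (P : Measure Ω)
    (act : ℕ → Ω → A) (rew : ℕ → Ω → ℝ) : Prop where
  measurable_act : ∀ n, Measurable (act n)
  measurable_rew : ∀ n, Measurable (rew n)
  act_law : ∀ (n : ℕ) (B : Set (Fin n → A × ℝ)), MeasurableSet B → ∀ a : A,
    P {ω | history act rew n ω ∈ B ∧ act n ω = a} =
      ∫⁻ ω in {ω | history act rew n ω ∈ B}, π n (history act rew n ω) a ∂P
  rew_law : ∀ (n : ℕ) (B : Set (Fin n → A × ℝ)), MeasurableSet B → ∀ (a : A) (C : Set ℝ),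
    MeasurableSet C →
    P {ω | history act rew n ω ∈ B ∧ act n ω = a ∧ rew n ω ∈ C} =
      P {ω | history act rew n ω ∈ B ∧ act n ω = a} * b.reward a C

/-- The random sequence of actions is risk-neutral: of any two actions of equal expectation, the
probabilities of being chosen in round `t` converge, as `t → ∞`, to the same limit. -/
def IsRiskNeutral (b : Problem A) {Ω : Type*} [MeasurableSpace Ω] (P : Measure Ω)
    (act : ℕ → Ω → A) : Prop :=
  ∀ a a' : A, b.mean a = b.mean a' → ∃ l : ℝ,
    Tendsto (fun n => P.real {ω | act n ω = a}) atTop (𝓝 l) ∧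
    Tendsto (fun n => P.real {ω | act n ω = a'}) atTop (𝓝 l)

section Greedy

variable [Fintype A] [Nonempty A]

open Classical in
/-- The actions that maximize `m`. -/
def argmax (m : A → ℝ) : Finset A := Finset.univ.filter fun a => ∀ a', m a' ≤ m a

theorem argmax_nonempty (m : A → ℝ) : (argmax m).Nonempty := by
  obtain ⟨a, -, ha⟩ := Finset.exists_max_image Finset.univ m Finset.univ_nonempty
  exact ⟨a, by simpa [argmax] using ha⟩

/-- The `ε`-greedy choice for the estimates `m`: uniform among the maximizers of `m` with
probability `1 - ε`, uniform among all actions with probability `ε`. -/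
def greedyChoice (ε : unitInterval) (m : A → ℝ) : PMF A :=
  PMF.ofFintype
    (fun a => ENNReal.ofReal (1 - (ε : ℝ)) * PMF.uniformOfFinset (argmax m) (argmax_nonempty m) a
      + ENNReal.ofReal (ε : ℝ) * PMF.uniformOfFintype A a) (by
    have key : ∀ p : PMF A, ∑ a, p a = 1 := fun p => by
      rw [← tsum_fintype (L := .unconditional A)]
      exact p.tsum_coe
    rw [Finset.sum_add_distrib, ← Finset.mul_sum, ← Finset.mul_sum, key, key, mul_one, mul_one,
      ← ENNReal.ofReal_add (sub_nonneg.2 ε.2.2) ε.2.1, sub_add_cancel, ENNReal.ofReal_one])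

open Classical in
/-- Reweighted `ε`-Greedy, with exploration probability `ε t` in round `t`. The estimate of an
action `a` before a round is the sum of all `r / √p` over the earlier rounds in which `a` was
chosen, divided by the number of these rounds; here `r` is the reward of the earlier round and `p`
the probability with which `a` was chosen there, given the history before it. The estimate of an
action that has not been chosen yet is `0 / 0 = 0`. -/
def reweightedGreedy (ε : ℕ → unitInterval) (n : ℕ) (h : Fin n → A × ℝ) : PMF A :=
  greedyChoice (ε (n + 1)) fun a =>
    (∑ s : Fin n, if (h s).1 = a then
        (h s).2 / √(reweightedGreedy ε s (fun i => h (Fin.castLE s.2.le i)) a).toReal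
      else 0) / ((Finset.univ.filter fun s : Fin n => (h s).1 = a).card : ℝ)
termination_by n
decreasing_by exact s.2

end Greedy

end Bandit

end

/-! Let `z` be the deterministic action, `a` the other one, and `S_n` the reweighted reward sum of
`a`. The estimate of `z` is almost surely always 0, and dividing by the number of plays does not
change a sign, so the propensity of `a` is 1/2 + (1 - ε)/2 · sign(S_n). Taking expectations, the
claim becomes P(S_n > 0) - P(S_n < 0) → 0.

This follows from a central limit theorem for `S_n`, although its increments are dependent. Given
the past, the increment is r/√p with probability p and 0 otherwise. Its conditional mean is 0 and
its conditional variance is p · v/p = v, whatever the past; its third absolute moment is of order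
1/√p. Hence φ_{k+1}(u) = (1 - v u²/2) φ_k(u) + O(|u|³/√p_min) for the characteristic functions φ_k
of `S_k` (`IsRun.norm_charFun_weightedReward_succ_sub_le`). Exploration keeps p above n^(-1/2)/2
during the first n rounds, so at u = t/√n the n errors add up to O(n · n^(-3/2) · n^(1/4)) → 0. Thus
S_n/√n tends to N(0, v), which is symmetric and has no atom at 0 if v > 0. If v = 0, then S_n = 0
almost surely. -/

/-! ### Second-order expansion of characteristic functions -/

theorem Complex.norm_exp_mul_I_sub_taylor_two_le (x : ℝ) :
    ‖Complex.exp (x * Complex.I) - 1 - x * Complex.I + (x : ℂ) ^ 2 / 2‖ ≤ 4 * |x| ^ 3 := by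
  have hn : ‖(x : ℂ) * Complex.I‖ = |x| := by simp
  have h0 := abs_nonneg x
  rcases le_or_gt |x| 1 with hx | hx
  · have h := Complex.exp_bound (x := x * Complex.I) (hn ▸ hx) (n := 3) (by norm_num)
    rw [hn] at h
    simp only [Finset.sum_range_succ, Finset.sum_range_zero, mul_pow, Complex.I_sq] at h
    norm_num [Nat.factorial] at h
    refine le_trans (le_of_eq ?_) (h.trans ?_)
    · congr 1; ring
    · nlinarith [pow_nonneg h0 3]
  -- For |x| > 1 no cancellation is needed: each term is dominated by |x|³, with total constant 1 +
  -- 1 + 1 + 1/2 ≤ 4.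
  · have h1 : ‖Complex.exp (x * Complex.I)‖ = 1 := Complex.norm_exp_ofReal_mul_I x
    have h2 : ‖(x : ℂ) ^ 2 / 2‖ = |x| ^ 2 / 2 := by simp
    have h3 : ‖Complex.exp (x * Complex.I) - 1 - x * Complex.I + (x : ℂ) ^ 2 / 2‖
        ≤ 1 + 1 + |x| + |x| ^ 2 / 2 := by
      refine (norm_add_le _ _).trans (add_le_add ((norm_sub_le _ _).trans (add_le_add
        ((norm_sub_le _ _).trans ?_) hn.le)) h2.le)
      simp [h1]
    have h4 : 1 ≤ |x| ^ 2 := one_le_pow₀ hx.le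
    have h5 : |x| ^ 2 ≤ |x| ^ 3 := pow_le_pow_right₀ hx.le (by norm_num)
    have h6 : |x| ≤ |x| ^ 2 := le_self_pow₀ hx.le (by norm_num)
    linarith

theorem MeasureTheory.norm_charFun_sub_taylor_two_le {F : Measure ℝ} [IsProbabilityMeasure F]
    (hF : MemLp id 3 F) (hmean : ∫ x, x ∂F = 0) (t : ℝ) :
    ‖charFun F t - (1 - (∫ x, x ^ 2 ∂F : ℝ) * (t : ℂ) ^ 2 / 2)‖
      ≤ 4 * (∫ x, |x| ^ 3 ∂F) * |t| ^ 3 := by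
  have i3 : Integrable (fun x : ℝ => |x| ^ 3) F := by
    simpa using hF.integrable_norm_pow (p := 3) (by norm_num)
  have i2 : Integrable (fun x : ℝ => x ^ 2) F := by
    simpa using (hF.mono_exponent (p := 2) (by norm_num)).integrable_sq
  have i1 : Integrable (fun x : ℝ => x) F :=
    (hF.mono_exponent (p := 1) (by norm_num)).integrable le_rfl
  have ie : Integrable (fun x : ℝ => Complex.exp (t * x * Complex.I)) F := by
    refine Integrable.of_bound (by fun_prop) 1 (ae_of_all _ fun x => ?_)
    exact_mod_cast (Complex.norm_exp_ofReal_mul_I (t * x)).le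
  have ia : Integrable (fun x : ℝ => (1 : ℂ) + (t * Complex.I) * x) F :=
    (integrable_const _).add (i1.ofReal.const_mul _)
  have ib : Integrable (fun x : ℝ => ((t : ℂ) ^ 2 / 2) * ((x ^ 2 : ℝ) : ℂ)) F :=
    i2.ofReal.const_mul _
  have key : charFun F t - (1 - (∫ x, x ^ 2 ∂F : ℝ) * (t : ℂ) ^ 2 / 2)
      = ∫ x : ℝ, (Complex.exp ((t * x : ℝ) * Complex.I) - 1 - (t * x : ℝ) * Complex.I
          + ((t * x : ℝ) : ℂ) ^ 2 / 2) ∂F := by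
    have e : ∀ x : ℝ, Complex.exp ((t * x : ℝ) * Complex.I) - 1 - (t * x : ℝ) * Complex.I
          + ((t * x : ℝ) : ℂ) ^ 2 / 2 = Complex.exp (t * x * Complex.I)
          - (1 + (t * Complex.I) * x) + ((t : ℂ) ^ 2 / 2) * ((x ^ 2 : ℝ) : ℂ) := by
      intro x; push_cast; ring
    simp_rw [e]
    have is : Integrable (fun x : ℝ => Complex.exp (t * x * Complex.I)
        - (1 + (t * Complex.I) * x)) F := ie.sub ia
    rw [integral_add is ib, integral_sub ie ia, integral_const_mul,
      integral_add (integrable_const _) (i1.ofReal.const_mul _), integral_const_mul,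
      integral_complex_ofReal, integral_complex_ofReal, hmean, charFun_apply_real]
    simp
    ring
  rw [key]
  refine (norm_integral_le_of_norm_le (i3.const_mul (4 * |t| ^ 3)) (ae_of_all _ fun x => ?_)).trans
    (le_of_eq ?_)
  · refine (Complex.norm_exp_mul_I_sub_taylor_two_le (t * x)).trans (le_of_eq ?_)
    rw [abs_mul, mul_pow, mul_assoc]
  · rw [integral_const_mul]; ring

/-- One step of the characteristic function recursion of an inverse propensity weighted sum. -/
theorem norm_integral_mul_exp_sub_le {Ω E : Type*} [MeasurableSpace Ω] [MeasurableSpace E]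
    {P : Measure Ω} [IsProbabilityMeasure P] {H : Ω → E} (hH : Measurable H)
    {R : Ω → ℝ} (hR : Measurable R) {T : Set Ω} (hT : MeasurableSet T)
    {p : E → ℝ} (hp : Measurable p) {δ : ℝ} (hδ : 0 < δ) (hpδ : ∀ x, δ ≤ p x)
    (hp1 : ∀ x, p x ≤ 1)
    {F : Measure ℝ} [IsProbabilityMeasure F] (hF : MemLp id 3 F) (hmean : ∫ x, x ∂F = 0)
    (hlaw : (P.restrict T).map (fun ω => (H ω, R ω))
      = ((P.map H).withDensity fun x => ENNReal.ofReal (p x)).prod F)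
    {f : E → ℂ} (hf : Measurable f) (hf1 : ∀ x, ‖f x‖ ≤ 1) (u : ℝ) :
    ‖(∫ ω, f (H ω) * Complex.exp ((u * T.indicator (fun ω => R ω / √(p (H ω))) ω : ℝ)
        * Complex.I) ∂P)
      - (1 - (∫ x, x ^ 2 ∂F : ℝ) * (u : ℂ) ^ 2 / 2) * ∫ ω, f (H ω) ∂P‖
      ≤ 4 * (∫ x, |x| ^ 3 ∂F) * |u| ^ 3 / √δ := by
  have : IsProbabilityMeasure (P.map H) := Measure.isProbabilityMeasure_map hH.aemeasurable
  set v : ℝ := ∫ x, x ^ 2 ∂F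
  set M : ℝ := ∫ x, |x| ^ 3 ∂F
  have hM : 0 ≤ M := integral_nonneg fun x => by positivity
  have hp0 : ∀ x, 0 < p x := fun x => hδ.trans_le (hpδ x)
  have hdens : Measurable fun x => Real.toNNReal (p x) := hp.real_toNNReal
  -- Off `T` the exponential equals 1, so subtracting 1 confines the effect of the new reward to
  -- `T`, where `hlaw` gives the joint law.
  set g : E × ℝ → ℂ := fun y => f y.1 * (Complex.exp ((u * (y.2 / √(p y.1)) : ℝ) * Complex.I) - 1)
  have hg : Measurable g := by fun_prop
  have hgb : ∀ y, ‖g y‖ ≤ 2 := by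
    intro y
    rw [norm_mul]
    calc ‖f y.1‖ * ‖Complex.exp ((u * (y.2 / √(p y.1)) : ℝ) * Complex.I) - 1‖ ≤ (1 : ℝ) * (1 + 1) := by
          refine mul_le_mul (hf1 _) ((norm_sub_le _ _).trans ?_) (norm_nonneg _) zero_le_one
          rw [Complex.norm_exp_ofReal_mul_I, norm_one]
      _ = 2 := by norm_num
  have hfi : Integrable (fun ω => f (H ω)) P :=
    Integrable.of_bound (hf.comp hH).aestronglyMeasurable 1 (ae_of_all _ fun _ => hf1 _)
  have hgi : Integrable (fun ω => g (H ω, R ω)) P :=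
    Integrable.of_bound (hg.comp (hH.prodMk hR)).aestronglyMeasurable 2 (ae_of_all _ fun _ => hgb _)
  have e1 : ∫ ω, f (H ω) * Complex.exp ((u * T.indicator (fun ω => R ω / √(p (H ω))) ω : ℝ)
        * Complex.I) ∂P = ∫ ω, f (H ω) ∂P + ∫ ω in T, g (H ω, R ω) ∂P := by
    rw [← integral_indicator hT, ← integral_add hfi (hgi.indicator hT)]
    refine integral_congr_ae (ae_of_all _ fun ω => ?_)
    by_cases h : ω ∈ T
    · simp [h, g]; ring
    · simp [h]
  have hfin : IsFiniteMeasure ((P.map H).withDensity fun x => ENNReal.ofReal (p x)) := by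
    refine isFiniteMeasure_withDensity_ofReal ?_
    refine Integrable.hasFiniteIntegral (Integrable.of_bound hp.aestronglyMeasurable 1
      (ae_of_all _ fun x => ?_))
    rw [Real.norm_of_nonneg (hp0 x).le]; exact hp1 x
  have e2 : ∫ ω in T, g (H ω, R ω) ∂P
      = ∫ x, (p x : ℂ) * (f x * (charFun F (u / √(p x)) - 1)) ∂(P.map H) := by
    rw [← integral_map (φ := fun ω => (H ω, R ω)) (hH.prodMk hR).aemeasurable
      hg.aestronglyMeasurable, hlaw,
      integral_prod _ (Integrable.of_bound hg.aestronglyMeasurable 2 (ae_of_all _ hgb))]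
    have : (fun x => ENNReal.ofReal (p x)) = fun x => ((Real.toNNReal (p x) : NNReal) : ENNReal) :=
      rfl
    rw [this, integral_withDensity_eq_integral_smul hdens]
    refine integral_congr_ae (ae_of_all _ fun x => ?_)
    have e3 : ∫ y, g (x, y) ∂F = f x * (charFun F (u / √(p x)) - 1) := by
      simp only [g]
      rw [integral_const_mul, integral_sub _ (integrable_const _), charFun_apply_real]
      · simp
        left; congr 1; ext y; congr 1; ring
      · refine Integrable.of_bound (by fun_prop) 1 (ae_of_all _ fun x => ?_)
        exact (Complex.norm_exp_ofReal_mul_I _).le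
    simp only [e3, NNReal.smul_def, Real.coe_toNNReal _ (hp0 x).le, Complex.real_smul]
  have e4 : ∫ ω, f (H ω) ∂P = ∫ x, f x ∂(P.map H) :=
    (integral_map hH.aemeasurable hf.aestronglyMeasurable).symm
  have hfi' : Integrable f (P.map H) :=
    Integrable.of_bound hf.aestronglyMeasurable 1 (ae_of_all _ hf1)
  have hci : Integrable (fun x => (p x : ℂ) * (f x * (charFun F (u / √(p x)) - 1))) (P.map H) := by
    refine Integrable.of_bound ?_ 2 (ae_of_all _ fun x => ?_)
    · have : Measurable (charFun F) := continuous_charFun.measurable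
      exact Measurable.aestronglyMeasurable (by fun_prop)
    · rw [norm_mul, norm_mul, Complex.norm_real, Real.norm_of_nonneg (hp0 x).le]
      have : ‖charFun F (u / √(p x)) - 1‖ ≤ 2 := by
        refine (norm_sub_le _ _).trans ?_
        have := norm_charFun_le_one (μ := F) (u / √(p x))
        rw [norm_one]; linarith
      calc p x * (‖f x‖ * ‖charFun F (u / √(p x)) - 1‖) ≤ 1 * (1 * 2) := by
            gcongr
            exacts [hp1 x, hf1 x]
        _ = 2 := by norm_num
  -- The weight 1/√p is chosen for this: p · (u/√p)² = u², so the second-order term is free of the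
  -- history and leaves the integral.
  have e5 : (∫ ω, f (H ω) * Complex.exp ((u * T.indicator (fun ω => R ω / √(p (H ω))) ω : ℝ)
        * Complex.I) ∂P)
      - (1 - (v : ℂ) * (u : ℂ) ^ 2 / 2) * ∫ ω, f (H ω) ∂P
      = ∫ x, f x * (p x * (charFun F (u / √(p x))
          - (1 - (v : ℂ) * ((u / √(p x) : ℝ) : ℂ) ^ 2 / 2))) ∂(P.map H) := by
    rw [e1, e2, e4]
    have : (∫ x, f x * (p x * (charFun F (u / √(p x))
          - (1 - (v : ℂ) * ((u / √(p x) : ℝ) : ℂ) ^ 2 / 2))) ∂(P.map H))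
        = ∫ x, ((p x : ℂ) * (f x * (charFun F (u / √(p x)) - 1))
          + ((v : ℂ) * (u : ℂ) ^ 2 / 2) * f x) ∂(P.map H) := by
      refine integral_congr_ae (ae_of_all _ fun x => ?_)
      have h : ((u / √(p x) : ℝ) : ℂ) ^ 2 = (u : ℂ) ^ 2 / p x := by
        rw [← Complex.ofReal_pow, div_pow, Real.sq_sqrt (hp0 x).le]; push_cast; rfl
      have h' : (p x : ℂ) ≠ 0 := by exact_mod_cast (hp0 x).ne'
      simp only [h]
      field_simp
      ring
    rw [this, integral_add hci (hfi'.const_mul _), integral_const_mul]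
    ring
  rw [e5]
  refine (norm_integral_le_of_norm_le (integrable_const (4 * M * |u| ^ 3 / √δ))
    (ae_of_all _ fun x => ?_)).trans (by simp)
  have hs : 0 < √(p x) := Real.sqrt_pos.2 (hp0 x)
  rw [norm_mul, norm_mul, Complex.norm_real, Real.norm_of_nonneg (hp0 x).le]
  -- At third order the cancellation is only partial: p · |u/√p|³ = |u|³/√p.
  calc _ ≤ 1 * (p x * (4 * M * |u / √(p x)| ^ 3)) := by
        refine mul_le_mul (hf1 x) ?_ (mul_nonneg (hp0 x).le (norm_nonneg _)) zero_le_one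
        exact mul_le_mul_of_nonneg_left (norm_charFun_sub_taylor_two_le hF hmean _) (hp0 x).le
    _ = 4 * M * |u| ^ 3 / √(p x) := by
        rw [abs_div, abs_of_pos hs]
        have : p x = √(p x) ^ 2 := (Real.sq_sqrt (hp0 x).le).symm
        nth_rewrite 1 [this]
        field_simp
    _ ≤ _ := by
        gcongr
        exact hpδ x

/-! ### Propensities of reweighted ε-greedy -/

namespace Bandit

theorem mem_argmax {A : Type*} [Fintype A] {m : A → ℝ} {a : A} :
    a ∈ argmax m ↔ ∀ a', m a' ≤ m a := by
  simp [argmax]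

section Strategy

variable {A : Type*} [Fintype A] [Nonempty A]

open Classical in
theorem greedyChoice_apply (e : unitInterval) (m : A → ℝ) (a : A) :
    greedyChoice e m a = ENNReal.ofReal (1 - (e : ℝ))
        * (if a ∈ argmax m then ((argmax m).card : ENNReal)⁻¹ else 0)
      + ENNReal.ofReal (e : ℝ) * (Fintype.card A : ENNReal)⁻¹ := by
  rw [greedyChoice, PMF.ofFintype_apply, PMF.uniformOfFinset_apply, PMF.uniformOfFintype_apply]

theorem le_toReal_greedyChoice (e : unitInterval) (m : A → ℝ) (a : A) :
    (e : ℝ) / Fintype.card A ≤ (greedyChoice e m a).toReal := by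
  have h : ENNReal.ofReal (e : ℝ) * (Fintype.card A : ENNReal)⁻¹ ≤ greedyChoice e m a := by
    classical
    rw [greedyChoice_apply]
    exact le_add_self
  have := ENNReal.toReal_mono ((greedyChoice e m).apply_ne_top a) h
  simpa [ENNReal.toReal_mul, ENNReal.toReal_ofReal e.2.1, div_eq_mul_inv] using this

theorem measurable_greedyChoice {E : Type*} [MeasurableSpace E] (e : unitInterval)
    {m : E → A → ℝ} (hm : ∀ a, Measurable fun x => m x a) (a : A) :
    Measurable fun x => greedyChoice e (m x) a := by
  classical
  have hset : ∀ a, MeasurableSet {x | a ∈ argmax (m x)} := by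
    intro a
    simp only [mem_argmax, Set.ofPred_forall]
    exact MeasurableSet.iInter fun a' => measurableSet_le (hm a') (hm a)
  have hcard : Measurable fun x => ((argmax (m x)).card : ENNReal) := by
    have : ∀ x, ((argmax (m x)).card : ENNReal) = ∑ a, if a ∈ argmax (m x) then 1 else 0 := by
      intro x; simp
    simp_rw [this]
    exact Finset.measurable_fun_sum _ fun a _ =>
      Measurable.ite (hset a) measurable_const measurable_const
  simp_rw [greedyChoice_apply]
  exact ((Measurable.ite (hset a) hcard.inv measurable_const).const_mul _).add measurable_const

/-- Of two actions, the `ε`-greedy choice prefers the one with the larger estimate. -/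
theorem toReal_greedyChoice_of_card_eq_two (hA : Fintype.card A = 2) {a z : A} (haz : a ≠ z)
    (e : unitInterval) (m : A → ℝ) :
    (greedyChoice e m a).toReal = 1 / 2 + (1 - e) / 2 * Real.sign (m a - m z) := by
  classical
  have huniv : (Finset.univ : Finset A) = {a, z} := by
    refine (Finset.eq_univ_of_card _ ?_).symm
    rw [Finset.card_pair haz, hA]
  have hall : ∀ q : A → Prop, (∀ x, q x) ↔ q a ∧ q z := by
    intro q
    have : (∀ x, q x) ↔ ∀ x ∈ (Finset.univ : Finset A), q x := by simp
    rw [this, huniv]; simp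
  have hmem : a ∈ argmax m ↔ m z ≤ m a := by rw [mem_argmax, hall]; simp
  have hmem' : z ∈ argmax m ↔ m a ≤ m z := by rw [mem_argmax, hall]; simp
  have harg : argmax m = ({a, z} : Finset A).filter (· ∈ argmax m) := by
    rw [← huniv]; ext; simp
  have h1 : 0 ≤ 1 - (e : ℝ) := sub_nonneg.2 e.2.2
  rw [greedyChoice_apply, hA, ENNReal.toReal_add (by
      refine ENNReal.mul_ne_top ENNReal.ofReal_ne_top ?_
      split_ifs with h
      · simpa using Finset.ne_empty_of_mem h
      · simp) (by finiteness), ENNReal.toReal_mul, ENNReal.toReal_mul,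
    ENNReal.toReal_ofReal e.2.1, ENNReal.toReal_ofReal h1]
  -- A tie gives probability 1/2, in accordance with `Real.sign 0 = 0`.
  rcases lt_trichotomy (m a) (m z) with h | h | h
  · rw [if_neg (by rw [hmem]; exact not_le.2 h), Real.sign_of_neg (by linarith)]
    simp; ring
  · have : argmax m = {a, z} := by
      rw [harg, Finset.filter_eq_self]; simp [hmem, hmem', h]
    rw [this, Finset.card_pair haz, h]
    simp; ring
  · have : argmax m = {a} := by
      rw [harg, Finset.filter_insert, if_pos (hmem.2 h.le), Finset.filter_singleton,
        if_neg (by rw [hmem']; exact not_le.2 h)]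
      rfl
    rw [this, Real.sign_of_pos (by linarith)]
    simp; ring

/-- The probability that reweighted `ε`-greedy chooses `a` after the history `h`. -/
noncomputable def propensity (ε : ℕ → unitInterval) (a : A) (n : ℕ) (h : Fin n → A × ℝ) : ℝ :=
  (reweightedGreedy ε n h a).toReal

open Classical in
/-- The inverse propensity weighted sum of the rewards of `a` in the history `h`. -/
noncomputable def weightedReward (ε : ℕ → unitInterval) (a : A) (n : ℕ)
    (h : Fin n → A × ℝ) : ℝ :=
  ∑ s : Fin n, if (h s).1 = a then
    (h s).2 / √(propensity ε a s fun i => h (Fin.castLE s.2.le i)) else 0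

open Classical in
theorem reweightedGreedy_eq (ε : ℕ → unitInterval) (n : ℕ) (h : Fin n → A × ℝ) :
    reweightedGreedy ε n h = greedyChoice (ε (n + 1)) fun a =>
      weightedReward ε a n h / ((Finset.univ.filter fun s : Fin n => (h s).1 = a).card : ℝ) := by
  rw [reweightedGreedy]
  rfl

theorem weightedReward_succ {Ω : Type*} {act : ℕ → Ω → A} {rew : ℕ → Ω → ℝ}
    (ε : ℕ → unitInterval) (a : A) (n : ℕ) (ω : Ω) :
    weightedReward ε a (n + 1) (history act rew (n + 1) ω)
      = weightedReward ε a n (history act rew n ω) + {ω | act n ω = a}.indicator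
        (fun ω => rew n ω / √(propensity ε a n (history act rew n ω))) ω := by
  classical
  rw [weightedReward, Fin.sum_univ_castSucc, Set.indicator_apply]
  rfl

theorem ofReal_propensity (ε : ℕ → unitInterval) (a : A) (n : ℕ) (h : Fin n → A × ℝ) :
    ENNReal.ofReal (propensity ε a n h) = reweightedGreedy ε n h a :=
  ENNReal.ofReal_toReal (PMF.apply_ne_top _ _)

theorem propensity_le_one (ε : ℕ → unitInterval) (a : A) (n : ℕ) (h : Fin n → A × ℝ) :
    propensity ε a n h ≤ 1 := by
  simpa [propensity] using
    ENNReal.toReal_mono ENNReal.one_ne_top ((reweightedGreedy ε n h).coe_le_one a)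

theorem le_propensity (ε : ℕ → unitInterval) (a : A) (n : ℕ) (h : Fin n → A × ℝ) :
    (ε (n + 1) : ℝ) / Fintype.card A ≤ propensity ε a n h := by
  rw [propensity, reweightedGreedy_eq]
  exact le_toReal_greedyChoice _ _ _

/-- Passing from the sum to the average divides by a positive count, which preserves the sign. If
`a` has not been played, the sum is empty and the default 0 / 0 = 0 agrees with it. -/
theorem propensity_eq_of_weightedReward_eq_zero (hA : Fintype.card A = 2) {a z : A} (haz : a ≠ z)
    (ε : ℕ → unitInterval) (n : ℕ) (h : Fin n → A × ℝ) (hz : weightedReward ε z n h = 0) :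
    propensity ε a n h = 1 / 2 + (1 - ε (n + 1)) / 2 * Real.sign (weightedReward ε a n h) := by
  classical
  rw [propensity, reweightedGreedy_eq, toReal_greedyChoice_of_card_eq_two hA haz, hz]
  congr 2
  rw [zero_div, sub_zero]
  set k := (Finset.univ.filter fun s : Fin n => (h s).1 = a).card with hk
  rcases Nat.eq_zero_or_pos k with h0 | h0
  · have : weightedReward ε a n h = 0 := by
      refine Finset.sum_eq_zero fun s _ => if_neg fun hs => ?_
      rw [hk, Finset.card_eq_zero] at h0
      exact Finset.notMem_empty s (h0 ▸ by simp [hs])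
    rw [this, zero_div]
  · have h0' : (0 : ℝ) < k := by exact_mod_cast h0
    rcases lt_trichotomy (weightedReward ε a n h) 0 with h | h | h
    · rw [Real.sign_of_neg h, Real.sign_of_neg (div_neg_of_neg_of_pos h h0')]
    · rw [h, zero_div]
    · rw [Real.sign_of_pos h, Real.sign_of_pos (div_pos h h0')]

variable [MeasurableSpace A] [MeasurableSingletonClass A]

/-- Sums and propensities are defined through each other; this is the half of the strong induction
that passes from earlier propensities to the current sum. -/
theorem measurable_weightedReward_of_lt (ε : ℕ → unitInterval) (n : ℕ)
    (H : ∀ s < n, ∀ a, Measurable fun h : Fin s → A × ℝ => propensity ε a s h) (a : A) :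
    Measurable (weightedReward ε a n) := by
  classical
  refine Finset.measurable_fun_sum _ fun s _ => Measurable.ite ?_ ?_ measurable_const
  · exact (measurable_fst.comp (measurable_pi_apply s)) (measurableSet_singleton a)
  · refine (measurable_snd.comp (measurable_pi_apply s)).div (Measurable.sqrt ?_)
    exact (H s s.2 a).comp (measurable_pi_lambda _ fun i => measurable_pi_apply _)

theorem measurable_propensity (ε : ℕ → unitInterval) (n : ℕ) (a : A) :
    Measurable fun h : Fin n → A × ℝ => propensity ε a n h := by
  classical
  induction n using Nat.strong_induction_on generalizing a with
  | _ n ih =>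
    simp_rw [propensity, reweightedGreedy_eq]
    refine (measurable_greedyChoice _ (fun a => ?_) a).ennreal_toReal
    refine (measurable_weightedReward_of_lt ε n (fun s hs a => ih s hs a) a).div ?_
    simp_rw [Finset.natCast_card_filter]
    refine Finset.measurable_fun_sum _ fun s _ =>
      Measurable.ite ?_ measurable_const measurable_const
    exact (measurable_fst.comp (measurable_pi_apply s)) (measurableSet_singleton a)

theorem measurable_weightedReward (ε : ℕ → unitInterval) (n : ℕ) (a : A) :
    Measurable (weightedReward ε a n) :=
  measurable_weightedReward_of_lt ε n (fun s _ a => measurable_propensity ε s a) a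

end Strategy

end Bandit

/-! ### From the recursion to asymptotic symmetry -/

/-- Multiplication by `q` does not amplify earlier errors, so the n one-step errors merely add up.
-/
theorem norm_sub_pow_le_of_norm_succ_sub_mul_le {φ : ℕ → ℂ} {q : ℂ} {c : ℝ} {n : ℕ} (h0 : φ 0 = 1)
    (hq : ‖q‖ ≤ 1) (h : ∀ k < n, ‖φ (k + 1) - q * φ k‖ ≤ c) : ‖φ n - q ^ n‖ ≤ n * c := by
  induction n with
  | zero => simp [h0]
  | succ n ih =>
    have h1 := ih fun k hk => h k (hk.trans n.lt_succ_self)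
    have h2 := h n n.lt_succ_self
    calc ‖φ (n + 1) - q ^ (n + 1)‖ = ‖(φ (n + 1) - q * φ n) + q * (φ n - q ^ n)‖ := by
          congr 1; ring
      _ ≤ c + 1 * (n * c) := by
          refine (norm_add_le _ _).trans (add_le_add h2 ?_)
          rw [norm_mul]
          exact mul_le_mul hq h1 (norm_nonneg _) zero_le_one
      _ = (n + 1 : ℕ) * c := by push_cast; ring

/-- This is the accumulated error of n steps at frequency t/√n with propensities at least
n^(-1/2)/2; it is of order n^(-1/4). -/
theorem tendsto_mul_div_sqrt_pow_three_div_sqrt (C t : ℝ) :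
    Tendsto (fun n : ℕ => (n : ℝ) * (C * |t / √(n : ℝ)| ^ 3 / √((√(n : ℝ))⁻¹ / 2)))
      atTop (𝓝 0) := by
  have h : Tendsto (fun n : ℕ => C * |t| ^ 3 * √2 / √√(n : ℝ)) atTop (𝓝 0) :=
    tendsto_const_nhds.div_atTop (Real.tendsto_sqrt_atTop.comp
      (Real.tendsto_sqrt_atTop.comp tendsto_natCast_atTop_atTop))
  refine h.congr' ?_
  filter_upwards [eventually_gt_atTop 0] with n hn
  have hn' : (0 : ℝ) < n := by exact_mod_cast hn
  obtain ⟨y, hy, hyn⟩ : ∃ y : ℝ, 0 < y ∧ √(n : ℝ) = y ^ 2 :=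
    ⟨√√(n : ℝ), by positivity, (Real.sq_sqrt (Real.sqrt_nonneg _)).symm⟩
  have hn4 : (n : ℝ) = y ^ 4 := by
    rw [← Real.sq_sqrt hn'.le, hyn]; ring
  rw [hyn, hn4, Real.sqrt_sq hy.le, abs_div, abs_of_pos (by positivity : 0 < y ^ 2),
    Real.sqrt_div (by positivity), Real.sqrt_inv, Real.sqrt_sq hy.le]
  field_simp

/-- If the characteristic functions of `μ n` are those of sums of `n` variables with variance `v`,
up to errors that are small after rescaling, then the rescaled laws have a Gaussian limit. -/
theorem tendsto_charFun_div_sqrt {μ : ℕ → Measure ℝ} {v C : ℝ} (hv : 0 ≤ v)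
    (h0 : ∀ u, charFun (μ 0) u = 1)
    (h : ∀ n k : ℕ, k < n → ∀ u : ℝ,
      ‖charFun (μ (k + 1)) u - (1 - (v : ℂ) * (u : ℂ) ^ 2 / 2) * charFun (μ k) u‖
        ≤ C * |u| ^ 3 / √((√(n : ℝ))⁻¹ / 2)) (t : ℝ) :
    Tendsto (fun n : ℕ => charFun (μ n) (t / √(n : ℝ))) atTop
      (𝓝 (Complex.exp (-(v * t ^ 2 / 2 : ℝ)))) := by
  set w : ℝ := v * t ^ 2 / 2 with hw
  have hw0 : 0 ≤ w := by positivity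
  have hpow := Complex.tendsto_one_add_div_pow_exp (-(w : ℂ))
  have key : ∀ᶠ n : ℕ in atTop, ‖charFun (μ n) (t / √(n : ℝ)) - (1 + -(w : ℂ) / n) ^ n‖
      ≤ (n : ℝ) * (C * |t / √(n : ℝ)| ^ 3 / √((√(n : ℝ))⁻¹ / 2)) := by
    -- Once n ≥ w, the factor 1 - w/n lies in [0, 1], as the accumulation of errors requires.
    filter_upwards [eventually_gt_atTop 0, eventually_ge_atTop ⌈w⌉₊] with n hn hnw
    have hn' : (0 : ℝ) < n := by exact_mod_cast hn
    have hq : (1 : ℂ) - (v : ℂ) * ((t / √(n : ℝ) : ℝ) : ℂ) ^ 2 / 2 = 1 + -(w : ℂ) / n := by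
      rw [← Complex.ofReal_pow, div_pow, Real.sq_sqrt hn'.le, hw]
      push_cast
      ring
    refine norm_sub_pow_le_of_norm_succ_sub_mul_le (φ := fun k => charFun (μ k) (t / √(n : ℝ)))
      (h0 _) ?_ fun k hk => ?_
    · have : (1 : ℂ) + -(w : ℂ) / n = ((1 - w / n : ℝ) : ℂ) := by push_cast; ring
      rw [this, Complex.norm_real, Real.norm_eq_abs, abs_le]
      have h1 : w / n ≤ 1 := (div_le_one hn').2 (Nat.ceil_le.1 hnw)
      have h2 : 0 ≤ w / n := by positivity
      constructor <;> linarith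
    · rw [← hq]
      exact h n k hk _
  have hdiff := squeeze_zero_norm' key (tendsto_mul_div_sqrt_pow_three_div_sqrt C t)
  have := hdiff.add hpow
  simpa using this

/-- If rescalings of the laws `μ n` converge to a centered nondegenerate Gaussian, then the positive
and the negative half-line have asymptotically the same mass. -/
theorem tendsto_measureReal_Ioi_sub_Iio {μ : ℕ → Measure ℝ} [∀ n, IsProbabilityMeasure (μ n)]
    {v : NNReal} (hv : v ≠ 0)
    (h : ∀ t : ℝ, Tendsto (fun n : ℕ => charFun (μ n) (t / √(n : ℝ))) atTop
      (𝓝 (Complex.exp (-(v * t ^ 2 / 2 : ℝ))))) :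
    Tendsto (fun n => (μ n).real (Set.Ioi 0) - (μ n).real (Set.Iio 0)) atTop (𝓝 0) := by
  have hm : ∀ n : ℕ, Measurable fun x : ℝ => (√(n : ℝ))⁻¹ * x := fun n => by fun_prop
  let ν : ℕ → ProbabilityMeasure ℝ := fun n =>
    ⟨(μ n).map fun x => (√(n : ℝ))⁻¹ * x, Measure.isProbabilityMeasure_map (hm n).aemeasurable⟩
  let γ : ProbabilityMeasure ℝ := ⟨gaussianReal 0 v, inferInstance⟩
  have hν : Tendsto ν atTop (𝓝 γ) := by
    refine ProbabilityMeasure.tendsto_iff_tendsto_charFun.2 fun t => ?_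
    have e : charFun (γ : Measure ℝ) t = Complex.exp (-(v * t ^ 2 / 2 : ℝ)) := by
      change charFun (gaussianReal 0 v) t = _
      rw [charFun_gaussianReal]
      congr 1
      push_cast
      ring
    rw [e]
    refine (h t).congr fun n => ?_
    change _ = charFun ((μ n).map fun x => (√(n : ℝ))⁻¹ * x) t
    rw [charFun_map_mul, div_eq_inv_mul]
  have : NullSingletonClass (gaussianReal 0 v) := nullSingletonClass_gaussianReal hv
  -- Portmanteau: the half-lines have boundary {0}, a null set of the Gaussian because v ≠ 0.
  have hlim : ∀ s : Set ℝ, frontier s = {0} →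
      Tendsto (fun n => (ν n : Measure ℝ).real s) atTop (𝓝 ((gaussianReal 0 v).real s)) := by
    intro s hs
    have := ProbabilityMeasure.tendsto_measure_of_null_frontier_of_tendsto' hν (E := s)
      (by
        rw [hs]
        change gaussianReal 0 v {0} = 0
        exact measure_singleton 0)
    exact (ENNReal.tendsto_toReal (measure_ne_top _ _)).comp this
  have hsymm : (gaussianReal 0 v).real (Set.Ioi 0) = (gaussianReal 0 v).real (Set.Iio 0) := by
    have h1 : (gaussianReal 0 v).map (fun x => -x) = gaussianReal 0 v := by
      rw [gaussianReal_map_neg, neg_zero]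
    conv_lhs => rw [← h1]
    rw [map_measureReal_apply measurable_neg measurableSet_Ioi]
    congr 1
    ext x
    simp
  have hd := (hlim (Set.Ioi 0) frontier_Ioi).sub (hlim (Set.Iio 0) frontier_Iio)
  rw [hsymm, sub_self] at hd
  refine hd.congr' ?_
  -- Rescaling by a positive factor preserves both half-lines; n = 0 is excluded because there the
  -- factor is 0.
  filter_upwards [eventually_gt_atTop 0] with n hn
  have hn' : 0 < (√(n : ℝ))⁻¹ := by
    have : (0 : ℝ) < n := by exact_mod_cast hn
    positivity
  change ((μ n).map fun x => (√(n : ℝ))⁻¹ * x).real _ - ((μ n).map fun x => (√(n : ℝ))⁻¹ * x).real _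
    = _
  rw [map_measureReal_apply (hm n) measurableSet_Ioi, map_measureReal_apply (hm n) measurableSet_Iio]
  congr 2 <;> ext x
  · exact mul_pos_iff_of_pos_left hn'
  · exact ⟨fun h => by simpa using neg_of_mul_neg_right h hn'.le, fun h => mul_neg_of_pos_of_neg hn' h⟩

/-! ### Runs of the algorithm -/

namespace Bandit

section Run

variable {A : Type*} [MeasurableSpace A] {b : Problem A}
  {Ω : Type*} [MeasurableSpace Ω] {P : Measure Ω}
  {act : ℕ → Ω → A} {rew : ℕ → Ω → ℝ}

theorem IsRun.measurable_history {π : Strategy A} (hrun : IsRun π b P act rew) (n : ℕ) :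
    Measurable (history act rew n) :=
  measurable_pi_lambda _ fun i => (hrun.measurable_act i).prodMk (hrun.measurable_rew i)

/-- This serves both the deterministic action and the degenerate case v = 0 of the other one. -/
theorem IsRun.ae_weightedReward_eq_zero [Fintype A] [Nonempty A] {ε : ℕ → unitInterval}
    (hrun : IsRun (reweightedGreedy ε) b P act rew) {a : A} (ha : b.reward a {0}ᶜ = 0) :
    ∀ᵐ ω ∂P, ∀ n, weightedReward ε a n (history act rew n ω) = 0 := by
  have h : ∀ n, ∀ᵐ ω ∂P, act n ω = a → rew n ω = 0 := by
    intro n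
    have := hrun.rew_law n Set.univ MeasurableSet.univ a {0}ᶜ (measurableSet_singleton 0).compl
    rw [ha, mul_zero] at this
    rw [ae_iff]
    simpa using this
  filter_upwards [ae_all_iff.2 h] with ω hω n
  refine Finset.sum_eq_zero fun s _ => ?_
  by_cases hs : act s ω = a
  · have : (history act rew n ω s).2 = 0 := hω s hs
    rw [this]; simp
  · exact if_neg hs

/-- On the event that `a` is chosen, the history and the reward are distributed according to the
product of the reward distribution with the law of the history, weighted by the strategy. -/
theorem IsRun.map_restrict_act_eq [IsProbabilityMeasure P] {π : Strategy A} (hrun : IsRun π b P act rew) (n : ℕ) (a : A)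
    (hπ : Measurable fun h => π n h a) :
    (P.restrict {ω | act n ω = a}).map (fun ω => (history act rew n ω, rew n ω))
      = ((P.map (history act rew n)).withDensity fun h => π n h a).prod (b.reward a) := by
  have hH := hrun.measurable_history n
  have := b.isProbabilityMeasure a
  have : IsProbabilityMeasure (P.map (history act rew n)) :=
    Measure.isProbabilityMeasure_map hH.aemeasurable
  have : IsFiniteMeasure ((P.map (history act rew n)).withDensity fun h => π n h a) := by
    refine isFiniteMeasure_withDensity (ne_top_of_le_ne_top ENNReal.one_ne_top ?_)
    calc _ ≤ ∫⁻ _, 1 ∂(P.map (history act rew n)) := lintegral_mono fun h => (π n h).coe_le_one a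
      _ = 1 := by simp
  refine (Measure.prod_eq fun B C hB hC => ?_).symm
  have hset : (fun ω => (history act rew n ω, rew n ω)) ⁻¹' B ×ˢ C ∩ {ω | act n ω = a}
      = {ω | history act rew n ω ∈ B ∧ act n ω = a ∧ rew n ω ∈ C} := by
    ext ω
    simp only [Set.mem_inter_iff, Set.mem_preimage, Set.mem_prod, Set.mem_ofPred_eq]
    tauto
  rw [Measure.map_apply (hH.prodMk (hrun.measurable_rew n)) (hB.prod hC),
    Measure.restrict_apply (hH.prodMk (hrun.measurable_rew n) (hB.prod hC)), hset,
    hrun.rew_law n B hB a C hC, hrun.act_law n B hB a, withDensity_apply _ hB,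
    setLIntegral_map hB hπ hH]
  rfl

variable [MeasurableSingletonClass A]

theorem IsRun.measurableSet_act_eq {π : Strategy A} (hrun : IsRun π b P act rew) (n : ℕ) (a : A) :
    MeasurableSet {ω | act n ω = a} :=
  hrun.measurable_act n (measurableSet_singleton a)

variable [Fintype A] [Nonempty A] {ε : ℕ → unitInterval}

theorem IsRun.measureReal_act_eq (hrun : IsRun (reweightedGreedy ε) b P act rew) (n : ℕ) (a : A) :
    P.real {ω | act n ω = a} = ∫ ω, propensity ε a n (history act rew n ω) ∂P := by
  have h := hrun.act_law n Set.univ MeasurableSet.univ a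
  simp only [Set.mem_univ, true_and, Set.ofPred_true, Measure.restrict_univ] at h
  have hm := (measurable_propensity ε n a).comp (hrun.measurable_history n)
  have h0 : ∀ ω, 0 ≤ propensity ε a n (history act rew n ω) := fun _ => ENNReal.toReal_nonneg
  rw [integral_eq_lintegral_of_nonneg_ae (ae_of_all _ h0) hm.aestronglyMeasurable,
    measureReal_def, h]
  simp_rw [ofReal_propensity]

variable [IsProbabilityMeasure P]

/-- The characteristic functions of the inverse propensity weighted reward sums of a centered
action satisfy, up to an error, the recursion for sums of i.i.d. rewards. -/
theorem IsRun.norm_charFun_weightedReward_succ_sub_le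
    (hrun : IsRun (reweightedGreedy ε) b P act rew) (a : A) (ha : b.IsCentered a)
    (hmem : MemLp id 3 (b.reward a)) (n : ℕ) {δ : ℝ} (hδ : 0 < δ)
    (hδε : δ ≤ (ε (n + 1) : ℝ) / Fintype.card A) (u : ℝ) :
    ‖charFun (P.map fun ω => weightedReward ε a (n + 1) (history act rew (n + 1) ω)) u
      - (1 - (∫ x, x ^ 2 ∂(b.reward a) : ℝ) * (u : ℂ) ^ 2 / 2)
        * charFun (P.map fun ω => weightedReward ε a n (history act rew n ω)) u‖
      ≤ 4 * (∫ x, |x| ^ 3 ∂(b.reward a)) * |u| ^ 3 / √δ := by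
  have := b.isProbabilityMeasure a
  have hS : ∀ n, Measurable fun ω => weightedReward ε a n (history act rew n ω) := fun n =>
    (measurable_weightedReward ε n a).comp (hrun.measurable_history n)
  have hφ : ∀ n, charFun (P.map fun ω => weightedReward ε a n (history act rew n ω)) u
      = ∫ ω, Complex.exp ((u * weightedReward ε a n (history act rew n ω) : ℝ) * Complex.I) ∂P := by
    intro n
    rw [charFun_apply_real, integral_map (hS n).aemeasurable
      (Measurable.aestronglyMeasurable (by fun_prop))]
    push_cast
    rfl
  have hw := measurable_weightedReward ε n a
  -- The factor `f` is exp(iu S_n), a function of the history; multiplying it by the exponential of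
  -- the new increment gives exp(iu S_{n+1}).
  have hstep := norm_integral_mul_exp_sub_le (hrun.measurable_history n) (hrun.measurable_rew n)
    (hrun.measurableSet_act_eq n a) (measurable_propensity ε n a) hδ
    (fun h => hδε.trans (le_propensity ε a n h)) (propensity_le_one ε a n) hmem ha
    (by
      simp_rw [ofReal_propensity]
      refine hrun.map_restrict_act_eq n a ?_
      simp_rw [← ofReal_propensity]
      exact (measurable_propensity ε n a).ennreal_ofReal)
    (f := fun h => Complex.exp ((u * weightedReward ε a n h : ℝ) * Complex.I))
    (by fun_prop) (fun h => (Complex.norm_exp_ofReal_mul_I _).le) u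
  rw [hφ, hφ]
  convert hstep using 5 with ω
  rw [← Complex.exp_add, ← add_mul, ← Complex.ofReal_add, ← mul_add, weightedReward_succ]

/-- The inverse propensity weighted reward sum of a centered action is asymptotically as likely to
be positive as to be negative. -/
theorem IsRun.tendsto_measureReal_weightedReward_pos_sub_neg
    (hrun : IsRun (reweightedGreedy ε) b P act rew) (hA : Fintype.card A = 2)
    (hε : ∀ n k : ℕ, k < n → (√(n : ℝ))⁻¹ ≤ ε (k + 1)) (a : A) (ha : b.IsCentered a) :
    Tendsto (fun n => P.real {ω | 0 < weightedReward ε a n (history act rew n ω)}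
      - P.real {ω | weightedReward ε a n (history act rew n ω) < 0}) atTop (𝓝 0) := by
  have := b.isProbabilityMeasure a
  have hmean : ∫ x, x ∂(b.reward a) = 0 := ha
  have hmem : ∀ p : NNReal, MemLp id p (b.reward a) := by
    intro p
    obtain ⟨c, hc⟩ := b.subGaussian a
    have := hc.memLp p
    simp only [hmean, sub_zero] at this
    exact this
  have hm3 : MemLp id 3 (b.reward a) := by exact_mod_cast hmem 3
  have hi2 : Integrable (fun x : ℝ => x ^ 2) (b.reward a) :=
    MemLp.integrable_sq (by exact_mod_cast hmem 2)
  set v : ℝ := ∫ x, x ^ 2 ∂(b.reward a) with hv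
  have hv0 : 0 ≤ v := integral_nonneg fun x => sq_nonneg x
  have hS : ∀ n, Measurable fun ω => weightedReward ε a n (history act rew n ω) := fun n =>
    (measurable_weightedReward ε n a).comp (hrun.measurable_history n)
  rcases hv0.eq_or_lt with hv1 | hv1
  -- With v = 0 the limit law would be an atom at 0 and say nothing about signs, but then the sum
  -- itself vanishes almost surely.
  · have hzero : b.reward a {0}ᶜ = 0 := by
      have := (integral_eq_zero_iff_of_nonneg (fun x => sq_nonneg x) hi2).1 hv1.symm
      have h2 : ∀ᵐ x ∂(b.reward a), x = 0 := by
        filter_upwards [this] with x hx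
        simpa using hx
      exact ae_iff.1 h2
    have h0 := hrun.ae_weightedReward_eq_zero hzero
    refine tendsto_const_nhds.congr fun n => ?_
    rw [eq_comm, sub_eq_zero]
    refine measureReal_congr ?_
    filter_upwards [h0] with ω hω
    change (0 < _) = (_ < 0)
    rw [hω n]
  · let μ : ℕ → Measure ℝ := fun n => P.map fun ω => weightedReward ε a n (history act rew n ω)
    have : ∀ n, IsProbabilityMeasure (μ n) := fun n =>
      Measure.isProbabilityMeasure_map (hS n).aemeasurable
    have hμ := tendsto_measureReal_Ioi_sub_Iio (μ := μ) (v := v.toNNReal)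
      (Real.toNNReal_pos.2 hv1).ne' (by
        rw [Real.coe_toNNReal _ hv0]
        refine tendsto_charFun_div_sqrt (C := 4 * ∫ x, |x| ^ 3 ∂(b.reward a)) hv0 (fun u => ?_)
          fun n k hk u => ?_
        · have : (fun ω => weightedReward ε a 0 (history act rew 0 ω)) = fun _ => 0 := by
            ext ω; simp [weightedReward]
          simp [μ, this, charFun_dirac]
        -- Here δ = n^(-1/2)/2 depends on the horizon n but not on the round k < n; the 2 is the
        -- number of actions.
        · refine hrun.norm_charFun_weightedReward_succ_sub_le a ha hm3 k ?_ ?_ u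
          · have : (0 : ℝ) < n := by exact_mod_cast (Nat.zero_le k).trans_lt hk
            positivity
          · rw [hA]
            push_cast
            exact div_le_div_of_nonneg_right (hε n k hk) zero_le_two)
    refine hμ.congr fun n => ?_
    rw [map_measureReal_apply (hS n) measurableSet_Ioi,
      map_measureReal_apply (hS n) measurableSet_Iio]
    rfl

/-- The expectation of sign(S_n) is the difference of the two tail probabilities. Its coefficient (1
- ε)/2 only needs to be bounded. -/
theorem IsRun.tendsto_measureReal_act_eq
    (hrun : IsRun (reweightedGreedy ε) b P act rew) (hA : Fintype.card A = 2)
    (hε : ∀ n k : ℕ, k < n → (√(n : ℝ))⁻¹ ≤ ε (k + 1)) {a z : A} (haz : a ≠ z)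
    (ha : b.IsCentered a) (hz : b.reward z {0}ᶜ = 0) :
    Tendsto (fun n => P.real {ω | act n ω = a}) atTop (𝓝 (1 / 2)) := by
  have hS : ∀ n, Measurable fun ω => weightedReward ε a n (history act rew n ω) := fun n =>
    (measurable_weightedReward ε n a).comp (hrun.measurable_history n)
  have hlim := hrun.tendsto_measureReal_weightedReward_pos_sub_neg hA hε a ha
  have hform : ∀ n, P.real {ω | act n ω = a} - 1 / 2 = (1 - ε (n + 1)) / 2 *
      (P.real {ω | 0 < weightedReward ε a n (history act rew n ω)}
        - P.real {ω | weightedReward ε a n (history act rew n ω) < 0}) := by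
    intro n
    have hpos : MeasurableSet {ω | 0 < weightedReward ε a n (history act rew n ω)} :=
      hS n measurableSet_Ioi
    have hneg : MeasurableSet {ω | weightedReward ε a n (history act rew n ω) < 0} :=
      hS n measurableSet_Iio
    have hp1 := (integrable_const (μ := P) (1 : ℝ)).indicator hpos
    have hn1 := (integrable_const (μ := P) (1 : ℝ)).indicator hneg
    have : ∫ ω, propensity ε a n (history act rew n ω) ∂P = ∫ ω, (1 / 2 + (1 - ε (n + 1)) / 2 *
        ({ω | 0 < weightedReward ε a n (history act rew n ω)}.indicator (fun _ => (1 : ℝ)) ω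
        - {ω | weightedReward ε a n (history act rew n ω) < 0}.indicator (fun _ => (1 : ℝ)) ω))
        ∂P := by
      refine integral_congr_ae ?_
      filter_upwards [hrun.ae_weightedReward_eq_zero hz] with ω hω
      rw [propensity_eq_of_weightedReward_eq_zero hA haz ε n _ (hω n)]
      congr 2
      simp only [Set.indicator_apply, Set.mem_ofPred_eq]
      rcases lt_trichotomy (weightedReward ε a n (history act rew n ω)) 0 with h | h | h
      · simp [Real.sign_of_neg h, h, h.not_gt]
      · simp [h]
      · simp [Real.sign_of_pos h, h, h.not_gt]
    have hd : Integrable (fun ω =>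
        {ω | 0 < weightedReward ε a n (history act rew n ω)}.indicator (fun _ => (1 : ℝ)) ω
        - {ω | weightedReward ε a n (history act rew n ω) < 0}.indicator (fun _ => (1 : ℝ)) ω) P :=
      hp1.sub hn1
    rw [hrun.measureReal_act_eq n a, this,
      integral_add (integrable_const _) (hd.const_mul _), integral_const_mul,
      integral_sub hp1 hn1, integral_indicator_const _ hpos, integral_indicator_const _ hneg]
    simp
  rw [← tendsto_sub_nhds_zero_iff]
  refine squeeze_zero_norm (fun n => ?_) (tendsto_zero_iff_norm_tendsto_zero.1 hlim)
  rw [hform, norm_mul]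
  refine mul_le_of_le_one_left (norm_nonneg _) ?_
  have := (ε (n + 1)).2
  rw [Real.norm_eq_abs, abs_le]
  constructor <;> linarith [this.1, this.2]

end Run

end Bandit

/-! ### The exploration rate t^(-1/2+κ) -/

theorem theorem2 {A : Type*} [Fintype A] [Nonempty A] [MeasurableSpace A]
    [MeasurableSingletonClass A] (hA : Fintype.card A = 2)
    (κ : ℝ) (hκ : κ ∈ Set.Ioo (0 : ℝ) (1 / 2))
    (ε : ℕ → unitInterval) (hε : ∀ t : ℕ, 1 ≤ t → (ε t : ℝ) = (t : ℝ) ^ (-(1 / 2 : ℝ) + κ))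
    (b : Bandit.Problem A) (hcentered : ∀ a, b.IsCentered a) (hdet : ∃ a, b.IsDeterministic a)
    {Ω : Type*} [MeasurableSpace Ω] (P : Measure Ω) [IsProbabilityMeasure P]
    (act : ℕ → Ω → A) (rew : ℕ → Ω → ℝ)
    (hrun : Bandit.IsRun (Bandit.reweightedGreedy ε) b P act rew) :
    Bandit.IsRiskNeutral b P act ∧
      ∀ a, Tendsto (fun n => P.real {ω | act n ω = a}) atTop (𝓝 (1 / 2)) := by
  suffices h : ∀ a, Tendsto (fun n => P.real {ω | act n ω = a}) atTop (𝓝 (1 / 2)) from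
    ⟨fun a a' _ => ⟨1 / 2, h a, h a'⟩, h⟩
  classical
  obtain ⟨z, c, hz⟩ := hdet
  have hz0 : b.reward z {0}ᶜ = 0 := by
    have hc : c = 0 := by
      have h : ∫ x, x ∂(b.reward z) = 0 := hcentered z
      simpa [hz] using h
    rw [hz, hc]; simp
  -- As κ > 0, ε_{k+1} ≥ (k+1)^(-1/2) ≥ n^(-1/2); the round with index k has number k + 1 ≤ n.
  have hε' : ∀ n k : ℕ, k < n → (√(n : ℝ))⁻¹ ≤ ε (k + 1) := by
    intro n k hk
    have h1 : (1 : ℝ) ≤ (k + 1 : ℕ) := by exact_mod_cast Nat.succ_pos k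
    have h2 : ((k + 1 : ℕ) : ℝ) ≤ n := by exact_mod_cast hk
    rw [hε _ (Nat.succ_pos k)]
    calc (√(n : ℝ))⁻¹ ≤ (√((k + 1 : ℕ) : ℝ))⁻¹ := by
          gcongr
      _ = ((k + 1 : ℕ) : ℝ) ^ (-(1 / 2 : ℝ)) := by
          rw [Real.sqrt_eq_rpow, Real.rpow_neg (by linarith)]
      _ ≤ _ := Real.rpow_le_rpow_of_exponent_le h1 (by linarith [hκ.1])
  obtain ⟨a, ha⟩ : ∃ a, a ≠ z := by
    have : Nontrivial A := Fintype.one_lt_card_iff_nontrivial.1 (by omega)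
    exact exists_ne z
  have hlim := hrun.tendsto_measureReal_act_eq hA hε' ha (hcentered a) hz0
  have hall : ∀ x, x = a ∨ x = z := by
    intro x
    have : ({a, z} : Finset A) = Finset.univ :=
      Finset.eq_univ_of_card _ (by rw [Finset.card_pair ha, hA])
    have hx := Finset.mem_univ x
    rw [← this] at hx
    simpa using hx
  intro x
  rcases hall x with rfl | rfl
  · exact hlim
  · have hcompl : ∀ n, P.real {ω | act n ω = x} = 1 - P.real {ω | act n ω = a} := by
      intro n
      rw [← probReal_compl_eq_one_sub (hrun.measurableSet_act_eq n a)]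
      congr 1
      ext ω
      rcases hall (act n ω) with h | h <;> simp [h, ha, ha.symm]
    simp_rw [hcompl]
    have := hlim.const_sub 1
    norm_num at this ⊢
    exact this
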